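/- Let $n\in\mathbb N$, let $\Omega\subset\mathbb R^n$ be a bounded open set (for instance a bounded convex domain with smooth boundary), let $T>0$, and let $u:\Omega\to\mathbb R$ be an external potential. Consider the Poisson--Boltzmann problem $$-\Delta U(x)=\frac{e^{-(U(x)+u(x))/T}}{\int_\Omega e^{-(U(y)+u(y))/T}\,dy}\quad\text{in }\Omega,\qquad U=0\quad\text{on }\partial\Omega, \tag{1}$$ where for a solution $U$ it is understood that $e^{-(U+u)/T}\in L^1(\Omega)$. Then (1) has at most one solution, in each of the following senses. 1. (Weak solutions; these include solutions $U\in H^2(\Omega)\cap H^1_0(\Omega)$ satisfying the equation almost everywhere.) If $U_1,U_2\in H^1_0(\Omega)$ both satisfy $e^{-(U_i+u)/T}\in L^1(\Omega)$ and $$\int_\Omega\nabla U_i\cdot\nabla\varphi\,dx=\int_\Omega\frac{e^{-(U_i+u)/T}}{\int_\Omega e^{-(U_i+u)/T}\,dy}\,\varphi\,dx\qquad\text{for all }\varphi\in C_c^\infty(\Omega),$$ then $U_1=U_2$ almost everywhere in $\Omega$. 2. (Classical solutions.) If $U_1,U_2\in C^2(\Omega)\cap C(\overline\Omega)$ both satisfy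 $e^{-(U_i+u)/T}\in L^1(\Omega)$, satisfy the equation at every point of $\Omega$ and vanish on $\partial\Omega$, then $U_1=U_2$ on $\overline\Omega$. -/

import Mathlib

open scoped ContDiff

noncomputable section

namespace PoissonBoltzmann

/-- Points of `ℝⁿ` with the Euclidean norm. -/
abbrev E (n : ℕ) := EuclideanSpace ℝ (Fin n)

variable {n : ℕ}

/-- `φ ∈ C_c^∞(Ω)`. -/
structure IsTest (Ω : Set (E n)) (φ : E n → ℝ) : Prop where
  smooth : ContDiff ℝ ∞ φ
  compact : HasCompactSupport φ
  supp : tsupport φ ⊆ Ω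

/-- `U ∈ H¹(Ω)` with weak gradient `G ∈ L²(Ω; ℝⁿ)`. -/
structure HasH1Gradient (Ω : Set (E n)) (U : E n → ℝ) (G : E n → E n) : Prop where
  memLp : MeasureTheory.MemLp U 2 (MeasureTheory.volume.restrict Ω)
  memLp_grad : MeasureTheory.MemLp G 2 (MeasureTheory.volume.restrict Ω)
  weak : ∀ φ : E n → ℝ, IsTest Ω φ → ∀ v : E n,
    ∫ x in Ω, U x * fderiv ℝ φ x v = -∫ x in Ω, inner ℝ (G x) v * φ x

/-- `U ∈ H¹₀(Ω)` with weak gradient `G`: membership in `H¹(Ω)`, and `U` lies in the closure of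
`C_c^∞(Ω)` for the `H¹(Ω)` norm. -/
structure HasH10Gradient (Ω : Set (E n)) (U : E n → ℝ) (G : E n → E n) : Prop
    extends HasH1Gradient Ω U G where
  approx : ∀ ε : ENNReal, 0 < ε → ∃ φ : E n → ℝ, IsTest Ω φ ∧
    MeasureTheory.eLpNorm (fun x => φ x - U x) 2 (MeasureTheory.volume.restrict Ω) < ε ∧
    MeasureTheory.eLpNorm (fun x => gradient φ x - G x) 2 (MeasureTheory.volume.restrict Ω) < ε

/-- The weight `e^{-(U + u)/T}`. -/
def weight (T : ℝ) (u U : E n → ℝ) (x : E n) : ℝ := Real.exp (-(U x + u x) / T)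

/-- The normalized density `e^{-(U(x) + u(x))/T} / ∫_Ω e^{-(U + u)/T}`. -/
def density (Ω : Set (E n)) (T : ℝ) (u U : E n → ℝ) (x : E n) : ℝ :=
  weight T u U x / ∫ y in Ω, weight T u U y

/-- `U ∈ H¹₀(Ω)` is a weak solution of `-ΔU = e^{-(U+u)/T} / ∫_Ω e^{-(U+u)/T}` in `Ω`, `U = 0` on
`∂Ω`; finiteness of the normalizing integral is part of the notion. Solutions in
`H²(Ω) ∩ H¹₀(Ω)` that satisfy the equation almost everywhere are of this kind. -/
def IsWeakSolution (Ω : Set (E n)) (T : ℝ) (u U : E n → ℝ) : Prop :=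
  MeasureTheory.IntegrableOn (weight T u U) Ω ∧
  ∃ G : E n → E n, HasH10Gradient Ω U G ∧
    ∀ φ : E n → ℝ, IsTest Ω φ →
      ∫ x in Ω, inner ℝ (G x) (gradient φ x) = ∫ x in Ω, density Ω T u U x * φ x

/-- `U ∈ C²(Ω) ∩ C(Ω̄)` is a classical solution of the same boundary value problem. -/
structure IsClassicalSolution (Ω : Set (E n)) (T : ℝ) (u U : E n → ℝ) : Prop where
  contDiffOn : ContDiffOn ℝ 2 U Ω
  continuousOn : ContinuousOn U (closure Ω)
  integrableOn : MeasureTheory.IntegrableOn (weight T u U) Ω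
  equation : ∀ x ∈ Ω, -(Laplacian.laplacian U x) = density Ω T u U x
  boundary : ∀ x ∈ frontier Ω, U x = 0

end PoissonBoltzmann

end

/-!
Uniqueness for the Poisson–Boltzmann problem rests on the monotonicity of the nonlinearity. Write
`w = U₁ - U₂` and `f = ρ₁ - ρ₂` for the difference of the two normalized densities, so that
`-Δw = f`. The normalizing constants only shift the comparison of the densities: there is a constant
`a` such that `ρ₁ < ρ₂` exactly where `w > a` and `ρ₂ < ρ₁` exactly where `w < a` (`exists_level`).
Moreover `∫ f = 0`, since both densities have integral one.

Weak solutions. Since `f` is only integrable, `w` itself cannot be used as a test function, but the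
bounded function `arctan w` can, through smooth approximations `φⱼ → w` in `H¹`
(`integral_arctan_ge`). This gives
`½ ∫ |∇w|² / (1 + w²) ≤ ∫ f arctan w = ∫ f (arctan w - arctan a) ≤ 0`,
so `∇w = 0` almost everywhere, and the Poincaré inequality (`IsTest.poincare`) yields `w = 0`. In
dimension zero there is no weak solution on a nonempty domain, and the Poincaré inequality is not
needed.

Classical solutions. By symmetry `a ≤ 0`. Where `w < a` one has `Δw < 0`, which is impossible at an
interior minimum; since `w` vanishes on the boundary, `w ≥ a` on all of `Ω`. Hence `f ≤ 0`, and
`∫ f = 0` forces `f = 0`, that is, `w = a` throughout. The boundary is nonempty, because a solution is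
strictly superharmonic and attains its minimum over `Ω̄`, so `a = 0` (`eqOn_of_level_nonpos`).
-/

open MeasureTheory Filter Topology

namespace PoissonBoltzmann

variable {n : ℕ} {Ω : Set (E n)} {T : ℝ} {u U U₁ U₂ : E n → ℝ}

/-! ### The normalized density -/

lemma integral_weight_pos (hΩ : volume Ω ≠ 0) (hw : IntegrableOn (weight T u U) Ω) :
    0 < ∫ y in Ω, weight T u U y := by
  have : NeZero (volume.restrict Ω) := ⟨by simpa [Measure.restrict_eq_zero] using hΩ⟩
  exact integral_exp_pos hw

lemma density_eq_exp (hΩ : volume Ω ≠ 0) (hw : IntegrableOn (weight T u U) Ω) (x : E n) :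
    density Ω T u U x =
      Real.exp (-(U x + u x) / T - Real.log (∫ y in Ω, weight T u U y)) := by
  rw [Real.exp_sub, Real.exp_log (integral_weight_pos hΩ hw)]
  rfl

lemma integrableOn_density (hw : IntegrableOn (weight T u U) Ω) :
    IntegrableOn (density Ω T u U) Ω :=
  hw.div_const _

lemma integral_density (hΩ : volume Ω ≠ 0) (hw : IntegrableOn (weight T u U) Ω) :
    ∫ x in Ω, density Ω T u U x = 1 := by
  simp only [density]
  rw [integral_div, div_self (integral_weight_pos hΩ hw).ne']

/-- Monotonicity of the nonlinearity up to a constant: the normalizing integrals only shift the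
level `a` of `U₁ - U₂` at which the two densities coincide. -/
lemma exists_level (hT : 0 < T) (hΩ : volume Ω ≠ 0) (h₁ : IntegrableOn (weight T u U₁) Ω)
    (h₂ : IntegrableOn (weight T u U₂) Ω) :
    ∃ a : ℝ, ∀ x, (density Ω T u U₁ x < density Ω T u U₂ x ↔ a < U₁ x - U₂ x) ∧
      (density Ω T u U₂ x < density Ω T u U₁ x ↔ U₁ x - U₂ x < a) := by
  set z₁ := Real.log (∫ y in Ω, weight T u U₁ y) with hz₁
  set z₂ := Real.log (∫ y in Ω, weight T u U₂ y) with hz₂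
  refine ⟨T * (z₂ - z₁), fun x => ?_⟩
  rw [density_eq_exp hΩ h₁, density_eq_exp hΩ h₂, ← hz₁, ← hz₂, Real.exp_lt_exp, Real.exp_lt_exp]
  have key : (-(U₂ x + u x) / T - z₂) - (-(U₁ x + u x) / T - z₁) =
      (U₁ x - U₂ x - T * (z₂ - z₁)) / T := by
    field_simp
    ring
  constructor
  · rw [← sub_pos, key, div_pos_iff_of_pos_right hT, sub_pos]
  · rw [← sub_neg, key, div_neg_iff]
    simp [hT, not_lt.2 hT.le]

/-! ### Second derivatives at local extrema -/

lemma _root_.IsLocalMax.deriv_deriv_nonpos {f : ℝ → ℝ} {x : ℝ} (h : IsLocalMax f x)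
    (hc : ContinuousAt f x) : deriv (deriv f) x ≤ 0 := by
  by_contra! hpos
  -- A positive second derivative makes `x` a local minimum too, so `f` is constant near `x`.
  have hmin := isLocalMin_of_deriv_deriv_pos hpos h.deriv_eq_zero hc
  have hconst : f =ᶠ[𝓝 x] fun _ => f x := by
    filter_upwards [h, hmin] with y h₁ h₂ using le_antisymm h₁ h₂
  have := hconst.deriv.deriv_eq
  simp at this
  exact hpos.ne' this

lemma _root_.IsLocalMax.iteratedFDeriv_two_nonpos {F : Type*} [NormedAddCommGroup F]
    [NormedSpace ℝ F] {f : F → ℝ} {x : F} (h : IsLocalMax f x) (hf : ContDiffAt ℝ 2 f x) (v : F) :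
    iteratedFDeriv ℝ 2 f x ![v, v] ≤ 0 := by
  have hl : ∀ t : ℝ, HasDerivAt (fun t : ℝ => x + t • v) v t := fun t => by
    simpa using ((hasDerivAt_id t).smul_const v).const_add x
  have hl0 : Tendsto (fun t : ℝ => x + t • v) (𝓝 0) (𝓝 x) := by
    simpa [ContinuousAt] using (hl 0).continuousAt
  have hd : deriv (fun t : ℝ => f (x + t • v)) =ᶠ[𝓝 0] fun t => fderiv ℝ f (x + t • v) v := by
    have := hl0.eventually (hf.eventually (by simp))
    filter_upwards [this] with t ht
    exact ((ht.differentiableAt (by simp)).hasFDerivAt.comp_hasDerivAt t (hl t)).deriv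
  have hdd : HasDerivAt (fun t : ℝ => fderiv ℝ f (x + t • v) v)
      (fderiv ℝ (fderiv ℝ f) x v v) 0 := by
    have h1 : HasFDerivAt (fderiv ℝ f) (fderiv ℝ (fderiv ℝ f) x) (x + (0 : ℝ) • v) := by
      simpa using ((hf.fderiv_right (m := 1) (by norm_num)).differentiableAt
        (by simp)).hasFDerivAt
    exact (ContinuousLinearMap.apply ℝ ℝ v).hasFDerivAt.comp_hasDerivAt 0
      (h1.comp_hasDerivAt 0 (hl 0))
  have hmax : IsLocalMax (fun t : ℝ => f (x + t • v)) 0 := by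
    have := hl0.eventually h
    simpa [IsLocalMax, IsMaxFilter] using this
  have hcont : ContinuousAt (fun t : ℝ => f (x + t • v)) 0 := by
    have : Tendsto f (𝓝 x) (𝓝 (f x)) := hf.continuousAt
    simpa [ContinuousAt, Function.comp_def] using this.comp hl0
  have := hmax.deriv_deriv_nonpos hcont
  rw [hd.deriv_eq, hdd.deriv] at this
  rw [← iteratedFDerivWithin_univ, iteratedFDerivWithin_two_apply' f uniqueDiffOn_univ (by trivial)]
  simpa using this

lemma laplacian_nonpos_of_isLocalMax {f : E n → ℝ} {x : E n} (h : IsLocalMax f x)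
    (hf : ContDiffAt ℝ 2 f x) : Laplacian.laplacian f x ≤ 0 := by
  rw [InnerProductSpace.laplacian_eq_iteratedFDeriv_stdOrthonormalBasis]
  exact Finset.sum_nonpos fun i _ => h.iteratedFDeriv_two_nonpos hf _

lemma laplacian_nonneg_of_isLocalMin {f : E n → ℝ} {x : E n} (h : IsLocalMin f x)
    (hf : ContDiffAt ℝ 2 f x) : 0 ≤ Laplacian.laplacian f x := by
  have := laplacian_nonpos_of_isLocalMax h.neg hf.neg
  have e : (fun x => -f x) = -f := rfl
  rw [e, InnerProductSpace.laplacian_neg] at this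
  simpa using this

/-! ### Classical solutions -/

lemma laplacian_sub_eq (hΩ : IsOpen Ω) (h₁ : IsClassicalSolution Ω T u U₁)
    (h₂ : IsClassicalSolution Ω T u U₂) {x : E n} (hx : x ∈ Ω) :
    Laplacian.laplacian (U₁ - U₂) x = density Ω T u U₂ x - density Ω T u U₁ x := by
  have e := (h₁.contDiffOn.contDiffAt (hΩ.mem_nhds hx)).laplacian_sub
    (h₂.contDiffOn.contDiffAt (hΩ.mem_nhds hx))
  rw [e]
  linarith [h₁.equation x hx, h₂.equation x hx]

/-- If the minimum of a solution over `Ω̄` lay in `Ω`, then `-ΔU` would be nonpositive there, although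
the density is positive. -/
lemma IsClassicalSolution.frontier_nonempty (hΩ : IsOpen Ω) (hb : Bornology.IsBounded Ω)
    (hne : Ω.Nonempty) (h : IsClassicalSolution Ω T u U) : (frontier Ω).Nonempty := by
  obtain ⟨x, hx, hmin⟩ := hb.isCompact_closure.exists_isMinOn hne.closure h.continuousOn
  by_contra! hf
  have hxΩ : x ∈ Ω := by
    have := closure_eq_self_union_frontier Ω
    rw [hf, Set.union_empty] at this
    rwa [this] at hx
  have hloc : IsLocalMin U x :=
    (hmin.on_subset subset_closure).isLocalMin (hΩ.mem_nhds hxΩ)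
  have h1 := laplacian_nonneg_of_isLocalMin hloc (h.contDiffOn.contDiffAt (hΩ.mem_nhds hxΩ))
  have h2 := h.equation x hxΩ
  have hvol : volume Ω ≠ 0 := (hΩ.measure_pos volume hne).ne'
  rw [density_eq_exp hvol h.integrableOn] at h2
  linarith [Real.exp_pos (-(U x + u x) / T - Real.log (∫ y in Ω, weight T u U y))]

lemma eqOn_of_level_nonpos (hΩ : IsOpen Ω) (hb : Bornology.IsBounded Ω) (hne : Ω.Nonempty)
    (h₁ : IsClassicalSolution Ω T u U₁) (h₂ : IsClassicalSolution Ω T u U₂) {a : ℝ} (ha : a ≤ 0)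
    (hlt : ∀ x, density Ω T u U₁ x < density Ω T u U₂ x ↔ a < U₁ x - U₂ x)
    (hgt : ∀ x, density Ω T u U₂ x < density Ω T u U₁ x ↔ U₁ x - U₂ x < a) :
    Set.EqOn U₁ U₂ (closure Ω) := by
  have hvol : volume Ω ≠ 0 := (hΩ.measure_pos volume hne).ne'
  have hK := hb.isCompact_closure
  have hc : ContinuousOn (U₁ - U₂) (closure Ω) := h₁.continuousOn.sub h₂.continuousOn
  have hd : ∀ x ∈ Ω, ContDiffAt ℝ 2 (U₁ - U₂) x := fun x hx =>
    (h₁.contDiffOn.contDiffAt (hΩ.mem_nhds hx)).sub (h₂.contDiffOn.contDiffAt (hΩ.mem_nhds hx))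
  have hint : ∀ x ∈ closure Ω, U₁ x - U₂ x ≠ 0 → x ∈ Ω := fun x hx h0 => by
    rw [closure_eq_self_union_frontier] at hx
    rcases hx with hx | hx
    · exact hx
    · simp [h₁.boundary x hx, h₂.boundary x hx] at h0
  obtain ⟨p, hp, hmin⟩ := hK.exists_isMinOn hne.closure hc
  -- Where `U₁ - U₂ < a` the difference is superharmonic, so its minimum is at least `a`.
  have hpa : a ≤ U₁ p - U₂ p := by
    by_contra! hlt'
    have hpΩ := hint p hp (by linarith)
    have := laplacian_nonneg_of_isLocalMin
      ((hmin.on_subset subset_closure).isLocalMin (hΩ.mem_nhds hpΩ)) (hd p hpΩ)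
    rw [laplacian_sub_eq hΩ h₁ h₂ hpΩ] at this
    linarith [(hgt p).2 hlt']
  have hle : ∀ x ∈ closure Ω, a ≤ U₁ x - U₂ x := fun x hx => hpa.trans (hmin hx)
  -- The densities are thus ordered on `Ω`, and having the same integral they agree.
  have hdens : ∀ x ∈ Ω, density Ω T u U₁ x ≤ density Ω T u U₂ x := fun x hx =>
    not_lt.1 fun h => not_lt.2 (hle x (subset_closure hx)) ((hgt x).1 h)
  have hae : density Ω T u U₁ =ᵐ[volume.restrict Ω] density Ω T u U₂ := by
    refine (integral_eq_iff_of_ae_le (integrableOn_density h₁.integrableOn)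
      (integrableOn_density h₂.integrableOn) ?_).1 ?_
    · exact ae_restrict_of_forall_mem hΩ.measurableSet hdens
    · rw [integral_density hvol h₁.integrableOn, integral_density hvol h₂.integrableOn]
  have haeW : U₁ - U₂ =ᵐ[volume.restrict Ω] fun _ => a := by
    filter_upwards [hae] with x hx
    refine le_antisymm (not_lt.1 fun h => ?_) (not_lt.1 fun h => ?_)
    · exact ((hlt x).2 h).ne hx
    · exact ((hgt x).2 h).ne hx.symm
  have hW : Set.EqOn (U₁ - U₂) (fun _ => a) (closure Ω) :=
    (Measure.eqOn_open_of_ae_eq haeW hΩ (hc.mono subset_closure)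
      continuousOn_const).of_subset_closure hc continuousOn_const subset_closure subset_rfl
  obtain ⟨y, hy⟩ := h₁.frontier_nonempty hΩ hb hne
  have ha0 : a = 0 := by
    have := hW (frontier_subset_closure hy)
    simpa [h₁.boundary y hy, h₂.boundary y hy] using this.symm
  intro x hx
  have := hW hx
  simp only [Pi.sub_apply, ha0] at this
  linarith

theorem classical_unique (hΩ : IsOpen Ω) (hb : Bornology.IsBounded Ω) (hT : 0 < T)
    (h₁ : IsClassicalSolution Ω T u U₁) (h₂ : IsClassicalSolution Ω T u U₂) :
    Set.EqOn U₁ U₂ (closure Ω) := by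
  rcases Ω.eq_empty_or_nonempty with rfl | hne
  · simp
  have hvol : volume Ω ≠ 0 := (hΩ.measure_pos volume hne).ne'
  obtain ⟨a, ha⟩ := exists_level hT hvol h₁.integrableOn h₂.integrableOn
  rcases le_total a 0 with h0 | h0
  · exact eqOn_of_level_nonpos hΩ hb hne h₁ h₂ h0 (fun x => (ha x).1) (fun x => (ha x).2)
  · refine (eqOn_of_level_nonpos hΩ hb hne h₂ h₁ (neg_nonpos.2 h0) (fun x => ?_)
      (fun x => ?_)).symm
    · rw [(ha x).2]
      constructor <;> intro h <;> linarith
    · rw [(ha x).1]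
      constructor <;> intro h <;> linarith

/-! ### Square integrals -/

lemma integral_norm_sq_eq {α F : Type*} [MeasurableSpace α] {μ : Measure α}
    [NormedAddCommGroup F] {f : α → F} (hf : MemLp f 2 μ) :
    ∫ x, ‖f x‖ ^ 2 ∂μ = (eLpNorm f 2 μ).toReal ^ 2 := by
  have h0 : 0 ≤ ∫ x, ‖f x‖ ^ 2 ∂μ := integral_nonneg fun x => by positivity
  rw [hf.eLpNorm_eq_integral_rpow_norm (by norm_num) (by norm_num), ENNReal.toReal_ofReal
    (by positivity)]
  simp only [ENNReal.toReal_ofNat, Real.rpow_ofNat]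
  rw [inv_eq_one_div, ← Real.sqrt_eq_rpow, Real.sq_sqrt h0]

lemma tendsto_integral_norm_sq {α F : Type*} [MeasurableSpace α] {μ : Measure α}
    [NormedAddCommGroup F] {f : ℕ → α → F} (hf : ∀ j, MemLp (f j) 2 μ)
    (h : Tendsto (fun j => eLpNorm (f j) 2 μ) atTop (𝓝 0)) :
    Tendsto (fun j => ∫ x, ‖f j x‖ ^ 2 ∂μ) atTop (𝓝 0) := by
  simp_rw [fun j => integral_norm_sq_eq (hf j)]
  have := (ENNReal.tendsto_toReal ENNReal.zero_ne_top).comp h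
  simpa using this.pow 2

lemma integrable_real_inner {α F : Type*} [MeasurableSpace α] {μ : Measure α}
    [NormedAddCommGroup F] [InnerProductSpace ℝ F] {f g : α → F} (hf : MemLp f 2 μ)
    (hg : MemLp g 2 μ) : Integrable (fun x => inner ℝ (f x) (g x)) μ :=
  (hf.norm.integrable_mul hg.norm).mono' (hf.1.inner hg.1)
    (.of_forall fun x => norm_inner_le_norm (f x) (g x))

/-! ### Test functions -/

lemma gradient_sub_apply {φ ψ : E n → ℝ} {x : E n} (hφ : DifferentiableAt ℝ φ x)
    (hψ : DifferentiableAt ℝ ψ x) :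
    gradient (φ - ψ) x = gradient φ x - gradient ψ x := by
  simp only [gradient]
  rw [fderiv_sub hφ hψ, map_sub]

lemma IsTest.differentiable {φ : E n → ℝ} (h : IsTest Ω φ) : Differentiable ℝ φ :=
  h.smooth.differentiable (by simp)

lemma IsTest.sub {φ ψ : E n → ℝ} (hφ : IsTest Ω φ) (hψ : IsTest Ω ψ) : IsTest Ω (φ - ψ) where
  smooth := hφ.smooth.sub hψ.smooth
  compact := hφ.compact.sub hψ.compact
  supp := (tsupport_sub φ ψ).trans (Set.union_subset hφ.supp hψ.supp)

lemma IsTest.continuous_gradient {φ : E n → ℝ} (h : IsTest Ω φ) : Continuous (gradient φ) :=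
  (InnerProductSpace.toDual ℝ (E n)).symm.continuous.comp (h.smooth.continuous_fderiv (by simp))

lemma IsTest.memLp {φ : E n → ℝ} (h : IsTest Ω φ) {μ : Measure (E n)}
    [IsFiniteMeasureOnCompacts μ] : MemLp φ 2 μ :=
  h.smooth.continuous.memLp_of_hasCompactSupport h.compact

lemma IsTest.memLp_gradient {φ : E n → ℝ} (h : IsTest Ω φ) {μ : Measure (E n)}
    [IsFiniteMeasureOnCompacts μ] : MemLp (gradient φ) 2 μ :=
  h.continuous_gradient.memLp_of_hasCompactSupport
    ((h.compact.fderiv ℝ).comp_left (map_zero (InnerProductSpace.toDual ℝ (E n)).symm))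

lemma IsTest.arctan {φ : E n → ℝ} (h : IsTest Ω φ) : IsTest Ω (fun x => Real.arctan (φ x)) where
  smooth := h.smooth.arctan
  compact := h.compact.comp_left Real.arctan_zero
  supp := (tsupport_comp_subset Real.arctan_zero φ).trans h.supp

lemma gradient_arctan {φ : E n → ℝ} {x : E n} (h : DifferentiableAt ℝ φ x) :
    gradient (fun y => Real.arctan (φ y)) x = (1 / (1 + φ x ^ 2)) • gradient φ x := by
  simp only [gradient]
  rw [h.hasFDerivAt.arctan.fderiv, map_smul]

lemma IsTest.continuous_fderiv_apply {φ : E n → ℝ} (h : IsTest Ω φ) (v : E n) :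
    Continuous (fun x => fderiv ℝ φ x v) :=
  (h.smooth.continuous_fderiv (by simp)).clm_apply continuous_const

lemma IsTest.eq_zero {φ : E n → ℝ} (h : IsTest Ω φ) {x : E n} (hx : x ∉ Ω) : φ x = 0 :=
  image_eq_zero_of_notMem_tsupport fun h' => hx (h.supp h')

lemma IsTest.gradient_eq_zero {φ : E n → ℝ} (h : IsTest Ω φ) {x : E n} (hx : x ∉ Ω) :
    gradient φ x = 0 := by
  have : fderiv ℝ φ x = 0 := by
    by_contra h0
    exact hx (h.supp (support_fderiv_subset ℝ h0))
  simp [gradient, this]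

/-- Integration of `∂ᵢ(xᵢ φ²)`. -/
lemma IsTest.integral_sq_eq {φ : E n → ℝ} (h : IsTest Ω φ) (i : Fin n) :
    Integrable (fun x => x i * (2 * φ x * fderiv ℝ φ x (EuclideanSpace.single i 1))) ∧
      ∫ x, φ x ^ 2 = -∫ x, x i * (2 * φ x * fderiv ℝ φ x (EuclideanSpace.single i 1)) := by
  set v : E n := EuclideanSpace.single i 1 with hv
  have hφc := h.smooth.continuous
  have hdφ := h.continuous_fderiv_apply v
  have hdsq : ∀ x, fderiv ℝ (fun x => φ x ^ 2) x v = 2 * φ x * fderiv ℝ φ x v := fun x => by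
    rw [((h.differentiable x).hasFDerivAt.pow 2).fderiv]
    simp
  set p : E n →L[ℝ] ℝ := EuclideanSpace.proj i with hp
  have hpx : ∀ x : E n, p x = x i := fun x => rfl
  have hpv : p v = 1 := by rw [hpx, hv]; simp
  have hsqs : HasCompactSupport fun x => φ x ^ 2 :=
    h.compact.comp_left (g := fun t : ℝ => t ^ 2) (by simp)
  have hcs : HasCompactSupport fun x => 2 * φ x * fderiv ℝ φ x v :=
    (h.compact.mul_left (f := fun _ => (2 : ℝ))).mul_right
  have hsq : Integrable fun x => φ x ^ 2 := (hφc.pow 2).integrable_of_hasCompactSupport hsqs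
  have hI : Integrable fun x => p x * (2 * φ x * fderiv ℝ φ x v) :=
    (p.continuous.mul ((continuous_const.mul hφc).mul hdφ)).integrable_of_hasCompactSupport
      hcs.mul_left
  have hJ : Integrable fun x => p x * φ x ^ 2 :=
    (p.continuous.mul (hφc.pow 2)).integrable_of_hasCompactSupport hsqs.mul_left
  have hdp : ∀ x, fderiv ℝ p x v = 1 := fun x => by rw [p.fderiv, hpv]
  have hib := integral_mul_fderiv_eq_neg_fderiv_mul_of_integrable (μ := volume) (f := p)
    (g := fun x => φ x ^ 2) (v := v) (by simpa only [hdp, one_mul] using hsq)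
    (by simpa only [hdsq] using hI) hJ
    (fun x _ => p.differentiableAt) (fun x _ => (h.differentiable x).pow 2)
  simp only [hdsq, hdp, one_mul] at hib
  refine ⟨hI, ?_⟩
  simp only [hpx] at hib
  rw [hib, neg_neg]

/-- The **Poincaré inequality**, for a domain contained in the ball of radius `R`. -/
lemma IsTest.poincare {φ : E n → ℝ} (h : IsTest Ω φ) (i : Fin n) {R : ℝ}
    (hR : ∀ x ∈ Ω, ‖x‖ ≤ R) :
    ∫ x in Ω, ‖φ x‖ ^ 2 ≤ 4 * R ^ 2 * ∫ x in Ω, ‖gradient φ x‖ ^ 2 := by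
  rw [setIntegral_eq_integral_of_forall_compl_eq_zero fun x hx => by simp [h.eq_zero hx],
    setIntegral_eq_integral_of_forall_compl_eq_zero fun x hx => by simp [h.gradient_eq_zero hx]]
  obtain ⟨hI, hib⟩ := h.integral_sq_eq i
  set v : E n := EuclideanSpace.single i 1 with hv
  have hv1 : ‖v‖ = 1 := by simp [hv]
  have hsq : Integrable (fun x => φ x ^ 2) := h.memLp.integrable_sq
  have hgi : Integrable (fun x => ‖gradient φ x‖ ^ 2) := h.memLp_gradient.norm.integrable_sq
  have hpt : ∀ x : E n, -(x i * (2 * φ x * fderiv ℝ φ x v)) ≤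
      (1 / 2) * φ x ^ 2 + 2 * R ^ 2 * ‖gradient φ x‖ ^ 2 := fun x => by
    by_cases hx : x ∈ Ω
    · have h1 : |x i| ≤ R := (PiLp.norm_apply_le x i).trans (hR x hx)
      have h2 : |fderiv ℝ φ x v| ≤ ‖gradient φ x‖ := by
        have := (fderiv ℝ φ x).le_opNorm v
        rw [hv1, mul_one] at this
        rwa [gradient, LinearIsometryEquiv.norm_map]
      have h3 : |x i * fderiv ℝ φ x v| ≤ R * ‖gradient φ x‖ := by
        rw [abs_mul]
        exact mul_le_mul h1 h2 (abs_nonneg _) ((abs_nonneg _).trans h1)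
      have h4 : (x i * fderiv ℝ φ x v) ^ 2 ≤ (R * ‖gradient φ x‖) ^ 2 :=
        sq_le_sq' (abs_le.1 h3).1 (abs_le.1 h3).2
      nlinarith [sq_nonneg (φ x + 2 * (x i * fderiv ℝ φ x v))]
    · rw [h.eq_zero hx]
      simp only [mul_zero, zero_mul, neg_zero]
      positivity
  have hmono := integral_mono hI.neg ((hsq.const_mul _).add (hgi.const_mul _)) hpt
  have hL : ∫ x, -(x i * (2 * φ x * fderiv ℝ φ x v)) = ∫ x, φ x ^ 2 := by rw [integral_neg, hib]
  have hRR : ∫ x, ((1 / 2) * φ x ^ 2 + 2 * R ^ 2 * ‖gradient φ x‖ ^ 2) =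
      (1 / 2) * (∫ x, φ x ^ 2) + 2 * R ^ 2 * ∫ x, ‖gradient φ x‖ ^ 2 := by
    rw [integral_add (hsq.const_mul _) (hgi.const_mul _), integral_const_mul, integral_const_mul]
  have hfin := hL.symm.le.trans (hmono.trans hRR.le)
  simp only [Real.norm_eq_abs, sq_abs]
  linarith

/-! ### Weak solutions -/

/-- Differences of `H¹₀` functions are limits of test functions, in `H¹` and almost everywhere. -/
lemma exists_seq_isTest {G₁ G₂ : E n → E n} (h₁ : HasH10Gradient Ω U₁ G₁)
    (h₂ : HasH10Gradient Ω U₂ G₂) :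
    ∃ φ : ℕ → E n → ℝ, (∀ j, IsTest Ω (φ j)) ∧
      Tendsto (fun j => ∫ x in Ω, ‖(φ j - (U₁ - U₂)) x‖ ^ 2) atTop (𝓝 0) ∧
      Tendsto (fun j => ∫ x in Ω, ‖(gradient (φ j) - (G₁ - G₂)) x‖ ^ 2) atTop (𝓝 0) ∧
      ∀ᵐ x ∂volume.restrict Ω, Tendsto (fun j => φ j x) atTop (𝓝 (U₁ x - U₂ x)) := by
  have hε : ∀ j : ℕ, (0 : ENNReal) < (j : ENNReal)⁻¹ := fun j => by simp
  choose φ₁ hφ₁ ha₁ hg₁ using fun j : ℕ => h₁.approx _ (hε j)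
  choose φ₂ hφ₂ ha₂ hg₂ using fun j : ℕ => h₂.approx _ (hε j)
  have hlim : Tendsto (fun j : ℕ => (j : ENNReal)⁻¹ + (j : ENNReal)⁻¹) atTop (𝓝 0) := by
    simpa using ENNReal.tendsto_inv_nat_nhds_zero.add ENNReal.tendsto_inv_nat_nhds_zero
  have ht : ∀ j, IsTest Ω (φ₁ j - φ₂ j) := fun j => (hφ₁ j).sub (hφ₂ j)
  have hL : Tendsto (fun j => eLpNorm ((φ₁ j - φ₂ j) - (U₁ - U₂)) 2 (volume.restrict Ω))
      atTop (𝓝 0) := by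
    refine tendsto_of_tendsto_of_tendsto_of_le_of_le tendsto_const_nhds hlim
      (fun _ => zero_le) fun j => ?_
    have e : (φ₁ j - φ₂ j) - (U₁ - U₂) = (φ₁ j - U₁) - (φ₂ j - U₂) := by abel
    rw [e]
    exact (eLpNorm_sub_le ((hφ₁ j).memLp.sub h₁.memLp).1 ((hφ₂ j).memLp.sub h₂.memLp).1
      (by norm_num)).trans (add_le_add (ha₁ j).le (ha₂ j).le)
  have hG : Tendsto (fun j => eLpNorm (gradient (φ₁ j - φ₂ j) - (G₁ - G₂)) 2 (volume.restrict Ω))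
      atTop (𝓝 0) := by
    refine tendsto_of_tendsto_of_tendsto_of_le_of_le tendsto_const_nhds hlim
      (fun _ => zero_le) fun j => ?_
    have e : gradient (φ₁ j - φ₂ j) - (G₁ - G₂) =
        (gradient (φ₁ j) - G₁) - (gradient (φ₂ j) - G₂) := by
      ext1 x
      simp only [Pi.sub_apply]
      rw [gradient_sub_apply ((hφ₁ j).differentiable x) ((hφ₂ j).differentiable x)]
      abel
    rw [e]
    exact (eLpNorm_sub_le ((hφ₁ j).memLp_gradient.sub h₁.memLp_grad).1
      ((hφ₂ j).memLp_gradient.sub h₂.memLp_grad).1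
      (by norm_num)).trans (add_le_add (hg₁ j).le (hg₂ j).le)
  obtain ⟨s, hs, hae⟩ := (tendstoInMeasure_of_tendsto_eLpNorm (by norm_num)
    (fun j => (ht j).memLp.1) (h₁.memLp.sub h₂.memLp).1 hL).exists_seq_tendsto_ae
  refine ⟨fun j => φ₁ (s j) - φ₂ (s j), fun j => ht _, ?_, ?_, hae⟩
  · exact tendsto_integral_norm_sq (fun j => (ht _).memLp.sub (h₁.memLp.sub h₂.memLp))
      (hL.comp hs.tendsto_atTop)
  · exact tendsto_integral_norm_sq
      (fun j => (ht _).memLp_gradient.sub (h₁.memLp_grad.sub h₂.memLp_grad))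
      (hG.comp hs.tendsto_atTop)

/-- `arctan w` is an admissible test function for `w ∈ H¹₀` even when the right-hand side `f` is only
integrable. Only the inequality that survives without convergence of the cross term is needed. -/
lemma integral_arctan_ge {w f : E n → ℝ} {G : E n → E n} {φ : ℕ → E n → ℝ}
    (hf : IntegrableOn f Ω) (hG : MemLp G 2 (volume.restrict Ω)) (hφ : ∀ j, IsTest Ω (φ j))
    (hgrad : Tendsto (fun j => ∫ x in Ω, ‖(gradient (φ j) - G) x‖ ^ 2) atTop (𝓝 0))
    (hae : ∀ᵐ x ∂volume.restrict Ω, Tendsto (fun j => φ j x) atTop (𝓝 (w x)))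
    (heq : ∀ ψ, IsTest Ω ψ → ∫ x in Ω, inner ℝ (G x) (gradient ψ x) = ∫ x in Ω, f x * ψ x) :
    ∫ x in Ω, (1 / 2) * (1 / (1 + w x ^ 2) * ‖G x‖ ^ 2) ≤ ∫ x in Ω, f x * Real.arctan (w x) := by
  have hGsq : IntegrableOn (fun x => ‖G x‖ ^ 2) Ω := hG.norm.integrable_sq
  have hle1 : ∀ t : ℝ, 1 / (1 + t ^ 2) ≤ 1 := fun t => by
    rw [div_le_one (by positivity)]
    nlinarith [sq_nonneg t]
  have hc1 : Continuous fun t : ℝ => 1 / (1 + t ^ 2) :=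
    continuous_const.div (by fun_prop) fun t => by positivity
  have hmeas : ∀ j, AEStronglyMeasurable (fun x => (1 / 2) * (1 / (1 + φ j x ^ 2) * ‖G x‖ ^ 2))
      (volume.restrict Ω) := fun j =>
    ((hc1.comp (hφ j).smooth.continuous).aestronglyMeasurable.mul hGsq.1).const_mul _
  have hbd : ∀ j x, ‖(1 / 2) * (1 / (1 + φ j x ^ 2) * ‖G x‖ ^ 2)‖ ≤ ‖G x‖ ^ 2 := fun j x => by
    rw [Real.norm_of_nonneg (by positivity)]
    nlinarith [mul_le_mul_of_nonneg_right (hle1 (φ j x)) (sq_nonneg ‖G x‖), sq_nonneg ‖G x‖]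
  have hlimL : Tendsto (fun j => ∫ x in Ω, (1 / 2) * (1 / (1 + φ j x ^ 2) * ‖G x‖ ^ 2)) atTop
      (𝓝 (∫ x in Ω, (1 / 2) * (1 / (1 + w x ^ 2) * ‖G x‖ ^ 2))) := by
    refine tendsto_integral_of_dominated_convergence _ hmeas hGsq
      (fun j => .of_forall (hbd j)) ?_
    filter_upwards [hae] with x hx
    exact (((hc1.tendsto _).comp hx).mul_const _).const_mul _
  have hlimR : Tendsto (fun j => ∫ x in Ω, f x * Real.arctan (φ j x)) atTop
      (𝓝 (∫ x in Ω, f x * Real.arctan (w x))) := by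
    refine tendsto_integral_of_dominated_convergence (fun x => ‖f x‖ * (Real.pi / 2))
      (fun j => hf.1.mul (hφ j).arctan.smooth.continuous.aestronglyMeasurable)
      (hf.norm.mul_const _) (fun j => .of_forall fun x => ?_) ?_
    · rw [norm_mul]
      gcongr
      exact abs_le.2 ⟨(Real.neg_pi_div_two_lt_arctan _).le, (Real.arctan_lt_pi_div_two _).le⟩
    · filter_upwards [hae] with x hx
      exact ((Real.continuous_arctan.tendsto _).comp hx).const_mul _
  have hdiff : ∀ j, ∫ x in Ω, (1 / 2) * (1 / (1 + φ j x ^ 2) * ‖G x‖ ^ 2) ≤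
      (∫ x in Ω, f x * Real.arctan (φ j x)) +
        (1 / 2) * ∫ x in Ω, ‖(gradient (φ j) - G) x‖ ^ 2 := fun j => by
    have hD : IntegrableOn (fun x => ‖(gradient (φ j) - G) x‖ ^ 2) Ω :=
      ((hφ j).memLp_gradient.sub hG).norm.integrable_sq
    have hI : IntegrableOn (fun x => inner ℝ (G x)
        (gradient (fun y => Real.arctan (φ j y)) x)) Ω := by
      exact integrable_real_inner hG (hφ j).arctan.memLp_gradient
    rw [← heq _ (hφ j).arctan, ← integral_const_mul, ← integral_add hI (hD.const_mul _)]
    refine integral_mono (hGsq.mono' (hmeas j) (.of_forall (hbd j))) (hI.add (hD.const_mul _))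
      fun x => ?_
    -- With `c = 1 / (1 + φ²) ≤ 1`: `c ⟨G, ∇φ⟩ = c ‖G‖² + c ⟨G, ∇φ - G⟩ ≥ c ‖G‖² / 2 - ‖∇φ - G‖² / 2`.
    simp only [Pi.sub_apply]
    rw [gradient_arctan ((hφ j).differentiable x), inner_smul_right]
    set c := 1 / (1 + φ j x ^ 2)
    have hc0 : 0 ≤ c := by positivity
    have h1 := norm_sub_sq_real (gradient (φ j) x) (G x)
    rw [real_inner_comm] at h1
    have h2 : c * ‖gradient (φ j) x - G x‖ ^ 2 ≤ 1 * ‖gradient (φ j) x - G x‖ ^ 2 := by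
      gcongr
      exact hle1 _
    have h3 : 0 ≤ c * ‖gradient (φ j) x‖ ^ 2 := by positivity
    have h4 : c * ‖gradient (φ j) x - G x‖ ^ 2 = c * ‖gradient (φ j) x‖ ^ 2 -
      2 * (c * inner ℝ (G x) (gradient (φ j) x)) + c * ‖G x‖ ^ 2 := by rw [h1]; ring
    linarith
  have := le_of_tendsto_of_tendsto' hlimL (hlimR.add (hgrad.const_mul (1 / 2))) hdiff
  simpa using this

/-- A limit in `L²` of test functions whose gradients tend to zero vanishes. -/
lemma ae_eq_zero_of_gradient_tendsto_zero (hb : Bornology.IsBounded Ω) (i : Fin n) {w : E n → ℝ}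
    {φ : ℕ → E n → ℝ} (hw : MemLp w 2 (volume.restrict Ω)) (hφ : ∀ j, IsTest Ω (φ j))
    (hL : Tendsto (fun j => ∫ x in Ω, ‖(φ j - w) x‖ ^ 2) atTop (𝓝 0))
    (hgrad : Tendsto (fun j => ∫ x in Ω, ‖gradient (φ j) x‖ ^ 2) atTop (𝓝 0)) :
    w =ᵐ[volume.restrict Ω] 0 := by
  obtain ⟨R, hR⟩ := hb.exists_norm_le
  have hwsq : IntegrableOn (fun x => w x ^ 2) Ω := hw.integrable_sq
  have hle : ∀ j, ∫ x in Ω, w x ^ 2 ≤ 2 * (∫ x in Ω, ‖(φ j - w) x‖ ^ 2) +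
      2 * (4 * R ^ 2 * ∫ x in Ω, ‖gradient (φ j) x‖ ^ 2) := fun j => by
    have hA : IntegrableOn (fun x => ‖(φ j - w) x‖ ^ 2) Ω :=
      ((hφ j).memLp.sub hw).norm.integrable_sq
    have hB : IntegrableOn (fun x => ‖φ j x‖ ^ 2) Ω := (hφ j).memLp.norm.integrable_sq
    refine le_trans ?_ (add_le_add_right
      (mul_le_mul_of_nonneg_left ((hφ j).poincare i hR) zero_le_two) _)
    rw [← integral_const_mul, ← integral_const_mul, ← integral_add (hA.const_mul _)
      (hB.const_mul _)]
    refine integral_mono hwsq ((hA.const_mul _).add (hB.const_mul _)) fun x => ?_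
    simp only [Pi.sub_apply, Real.norm_eq_abs, sq_abs]
    nlinarith [sq_nonneg (2 * φ j x - w x)]
  have h0 : ∫ x in Ω, w x ^ 2 ≤ 0 := by
    refine ge_of_tendsto' (x := atTop) ?_ hle
    simpa using (hL.const_mul 2).add ((hgrad.const_mul (4 * R ^ 2)).const_mul 2)
  have hz := (integral_eq_zero_iff_of_nonneg (fun x => sq_nonneg (w x)) hwsq).1
    (le_antisymm h0 (integral_nonneg fun x => sq_nonneg (w x)))
  filter_upwards [hz] with x hx
  simpa using hx

/-- In dimension zero the constant `1` is a test function with zero gradient, while the density has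
integral one. -/
lemma IsWeakSolution.dim_ne_zero (hvol : volume Ω ≠ 0) (h : IsWeakSolution Ω T u U) : n ≠ 0 := by
  rintro rfl
  obtain ⟨hw, G, -, heq⟩ := h
  have huniv : Ω = Set.univ := by
    have : Ω.Nonempty := nonempty_of_measure_ne_zero hvol
    exact Subsingleton.eq_univ_of_nonempty this
  have := heq (fun _ => 1) ⟨contDiff_const, HasCompactSupport.of_compactSpace _, by simp [huniv]⟩
  have e : ∀ x, (inner ℝ (G x) (gradient (fun _ : E 0 => (1 : ℝ)) x) : ℝ) = 0 := fun x => by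
    rw [Subsingleton.elim (G x) 0, inner_zero_left]
  simp only [e, mul_one, integral_zero] at this
  rw [integral_density hvol hw] at this
  exact zero_ne_one this

theorem weak_unique (hb : Bornology.IsBounded Ω) (hT : 0 < T)
    (h₁ : IsWeakSolution Ω T u U₁) (h₂ : IsWeakSolution Ω T u U₂) :
    U₁ =ᵐ[volume.restrict Ω] U₂ := by
  by_cases hvol : volume Ω = 0
  · rw [Measure.restrict_eq_zero.2 hvol]
    simp [Filter.EventuallyEq]
  have hn := h₁.dim_ne_zero hvol
  obtain ⟨hw₁, G₁, hG₁, heq₁⟩ := h₁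
  obtain ⟨hw₂, G₂, hG₂, heq₂⟩ := h₂
  obtain ⟨a, ha⟩ := exists_level hT hvol hw₁ hw₂
  obtain ⟨φ, hφ, hL, hgrad, hae⟩ := exists_seq_isTest hG₁ hG₂
  have hd₁ := integrableOn_density hw₁
  have hd₂ := integrableOn_density hw₂
  have hf : IntegrableOn (density Ω T u U₁ - density Ω T u U₂) Ω := hd₁.sub hd₂
  have hG : MemLp (G₁ - G₂) 2 (volume.restrict Ω) := hG₁.memLp_grad.sub hG₂.memLp_grad
  have hf0 : ∫ x in Ω, (density Ω T u U₁ - density Ω T u U₂) x = 0 := by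
    simp only [Pi.sub_apply]
    rw [integral_sub hd₁ hd₂, integral_density hvol hw₁, integral_density hvol hw₂, sub_self]
  have heq : ∀ ψ, IsTest Ω ψ → ∫ x in Ω, inner ℝ ((G₁ - G₂) x) (gradient ψ x) =
      ∫ x in Ω, (density Ω T u U₁ - density Ω T u U₂) x * ψ x := fun ψ hψ => by
    obtain ⟨C, hC⟩ := hψ.compact.exists_bound_of_continuous hψ.smooth.continuous
    have hm := hψ.smooth.continuous.aestronglyMeasurable (μ := volume.restrict Ω)
    simp only [Pi.sub_apply, inner_sub_left, sub_mul]
    rw [integral_sub (integrable_real_inner hG₁.memLp_grad hψ.memLp_gradient)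
      (integrable_real_inner hG₂.memLp_grad hψ.memLp_gradient), heq₁ ψ hψ, heq₂ ψ hψ,
      integral_sub (hd₁.mul_bdd hm (.of_forall hC)) (hd₂.mul_bdd hm (.of_forall hC))]
  have hge := integral_arctan_ge hf hG hφ hgrad hae heq
  have hwm : AEStronglyMeasurable (fun x => U₁ x - U₂ x) (volume.restrict Ω) :=
    hG₁.memLp.1.sub hG₂.memLp.1
  -- As `∫ f = 0`, the constant `arctan a` can be subtracted, and `f (arctan w - arctan a) ≤ 0`.
  have hle : ∫ x in Ω, (density Ω T u U₁ - density Ω T u U₂) x * Real.arctan (U₁ x - U₂ x) ≤ 0 := by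
    have hia : IntegrableOn (fun x => (density Ω T u U₁ - density Ω T u U₂) x *
        Real.arctan (U₁ x - U₂ x)) Ω :=
      hf.mul_bdd (c := Real.pi / 2) (Real.continuous_arctan.comp_aestronglyMeasurable hwm)
        (.of_forall fun x => abs_le.2
          ⟨(Real.neg_pi_div_two_lt_arctan _).le, (Real.arctan_lt_pi_div_two _).le⟩)
    have hic : IntegrableOn (fun x => (density Ω T u U₁ - density Ω T u U₂) x * Real.arctan a) Ω :=
      hf.mul_const _
    have h := integral_nonpos (μ := volume.restrict Ω)
      (f := fun x => (density Ω T u U₁ - density Ω T u U₂) x * Real.arctan (U₁ x - U₂ x) -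
        (density Ω T u U₁ - density Ω T u U₂) x * Real.arctan a) fun x => by
        simp only [Pi.sub_apply, Pi.zero_apply, ← mul_sub]
        rcases lt_trichotomy (U₁ x - U₂ x) a with hx | hx | hx
        · exact mul_nonpos_of_nonneg_of_nonpos (sub_nonneg.2 ((ha x).2.2 hx).le)
            (sub_nonpos.2 (Real.arctan_strictMono hx).le)
        · simp [hx]
        · exact mul_nonpos_of_nonpos_of_nonneg (sub_nonpos.2 ((ha x).1.2 hx).le)
            (sub_nonneg.2 (Real.arctan_strictMono hx).le)
    rw [integral_sub hia hic, integral_mul_const, hf0, zero_mul, sub_zero] at h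
    exact h
  have hGsq : IntegrableOn (fun x => ‖(G₁ - G₂) x‖ ^ 2) Ω := hG.norm.integrable_sq
  have hpos : ∀ x, 0 ≤ (1 / 2) * (1 / (1 + (U₁ x - U₂ x) ^ 2) * ‖(G₁ - G₂) x‖ ^ 2) :=
    fun x => by positivity
  have hGint : IntegrableOn
      (fun x => (1 / 2) * (1 / (1 + (U₁ x - U₂ x) ^ 2) * ‖(G₁ - G₂) x‖ ^ 2)) Ω := by
    refine (hGsq.bdd_mul (c := 1) ?_ (.of_forall fun x => ?_)).const_mul _
    · exact (continuous_const.div (by fun_prop) fun t => by positivity :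
        Continuous fun t : ℝ => 1 / (1 + t ^ 2)).comp_aestronglyMeasurable hwm
    · rw [Real.norm_of_nonneg (by positivity), div_le_one (by positivity)]
      nlinarith [sq_nonneg (U₁ x - U₂ x)]
  have hGz := (integral_eq_zero_iff_of_nonneg hpos hGint).1
    (le_antisymm (hge.trans hle) (integral_nonneg hpos))
  have hgrad' : Tendsto (fun j => ∫ x in Ω, ‖gradient (φ j) x‖ ^ 2) atTop (𝓝 0) := by
    refine hgrad.congr fun j => integral_congr_ae ?_
    filter_upwards [hGz] with x hx
    have h1 : (0 : ℝ) < 1 + (U₁ x - U₂ x) ^ 2 := by positivity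
    have : (G₁ - G₂) x = 0 := by simpa [h1.ne'] using hx
    rw [Pi.sub_apply, this, sub_zero]
  have := ae_eq_zero_of_gradient_tendsto_zero hb ⟨0, Nat.pos_of_ne_zero hn⟩
    (hG₁.memLp.sub hG₂.memLp) hφ hL hgrad'
  filter_upwards [this] with x hx
  exact sub_eq_zero.1 hx

end PoissonBoltzmann

theorem mainTheorem2 {n : ℕ} (Ω : Set (PoissonBoltzmann.E n)) (hΩ_open : IsOpen Ω)
    (hΩ_bdd : Bornology.IsBounded Ω) (T : ℝ) (hT : 0 < T) (u : PoissonBoltzmann.E n → ℝ) :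
    (∀ U₁ U₂ : PoissonBoltzmann.E n → ℝ,
      PoissonBoltzmann.IsWeakSolution Ω T u U₁ → PoissonBoltzmann.IsWeakSolution Ω T u U₂ →
        U₁ =ᵐ[MeasureTheory.volume.restrict Ω] U₂) ∧
    (∀ U₁ U₂ : PoissonBoltzmann.E n → ℝ,
      PoissonBoltzmann.IsClassicalSolution Ω T u U₁ →
      PoissonBoltzmann.IsClassicalSolution Ω T u U₂ → Set.EqOn U₁ U₂ (closure Ω)) := by
  exact ⟨fun _ _ => PoissonBoltzmann.weak_unique hΩ_bdd hT,
    fun _ _ => PoissonBoltzmann.classical_unique hΩ_open hΩ_bdd hT⟩
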